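/- Let $n$ be a natural number, let $N_n$ be the group of real unipotent upper triangular $n\times n$ matrices, and let $N_n^+\subset N_n$ be the set of totally positive matrices, i.e. of those $M\in N_n$ for which every minor that does not vanish identically on $N_n$ is positive. For $x>0$ put $$ l(x)=\frac{6}{\pi^2}\,L\Bigl(\frac{x}{1+x}\Bigr),\qquad L(u)=\mathrm{Li}_2(u)+\tfrac12\log u\,\log(1-u),\qquad \mathrm{Li}_2(u)=\sum_{k\ge1}\frac{u^k}{k^2}\qquad(0<u<1). $$ For $I,J\subset\{1,\dots,n\}$ let $\Delta_I(M)$ be the minor of $M$ with rows $I$ and the last $|I|$ columns, and $\Delta^J(M)$ the minor with the first $|J|$ rows and columns $J$ ($\Delta_\emptyset=\Delta^\emptyset=1$). Write $[a,b]=\{i\in\mathbb N: a\le i\le b\}$, and for $1\le a<b<c\le n$ set $$ Y_{abc}=\frac{\Delta_{[a,b-1]\cup[c+1,n]}\,\Delta_{[a+1,b]\cup[c,n]}}{\Delta_{[a,b]\cup[c+1,n]}\,\Delta_{[a+1,b-1]\cup[c,n]}},\qquad Y^{abc}=\frac{\Delta^{[a,b]\cup[c+1,n]}\,\Delta^{[a+1,b-1]\cup[c,n]}}{\Delta^{[a,b-1]\cup[c+1,n]}\,\Delta^{[a+1,b]\cup[c,n]}}.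 $$ Let $P$ be the permutation matrix $P_{ij}=\delta_{i+j,n+1}$. For $M\in N_n^+$ let $M',M''\in N_n$ be the unique unipotent upper triangular matrices such that $PMP=M'\,P\,D\,M''$ for some diagonal matrix $D$. Let $T_n=\{(a,b,c)\in\mathbb N^3: 1\le a<b<c\le n\}$. Then, for every $M\in N_n^+$, $$ \sum_{(a,b,c)\in T_n} l\bigl(Y_{abc}(M)\bigr)+\sum_{(a,b,c)\in T_n} l\bigl(Y_{abc}(M')\bigr)=\frac{n(n-1)(n-2)}{6}, $$ $$ \sum_{(a,b,c)\in T_n} l\bigl(Y^{abc}(M)\bigr)+\sum_{(a,b,c)\in T_n} l\bigl(Y^{abc}(M'')\bigr)=\frac{n(n-1)(n-2)}{6}. $$ -/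

import Mathlib

noncomputable section

namespace TotPos

/-- The dilogarithm `Li₂(x) = ∑_{k ≥ 1} x ^ k / k ^ 2` (convergent for `|x| ≤ 1`). -/
def Li2 (x : ℝ) : ℝ := ∑' k : ℕ, x ^ (k + 1) / ((k : ℝ) + 1) ^ 2

/-- The Rogers dilogarithm on `(0, 1)`. -/
def rogersL (x : ℝ) : ℝ := Li2 x + 1 / 2 * Real.log x * Real.log (1 - x)

/-- The normalised Rogers dilogarithm `l`, for `x > 0`. -/
def ell (x : ℝ) : ℝ := 6 / Real.pi ^ 2 * rogersL (x / (1 + x))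

variable {n : ℕ}

/-- The group `N_n` of unipotent upper triangular real matrices. -/
def IsUnipotentUpper (M : Matrix (Fin n) (Fin n) ℝ) : Prop :=
  (∀ i, M i i = 1) ∧ ∀ i j, j < i → M i j = 0

/-- The `k × k` minor with rows `r 0 < ⋯ < r (k-1)` and columns `c 0 < ⋯ < c (k-1)`. -/
def minor {k : ℕ} (M : Matrix (Fin n) (Fin n) ℝ) (r c : Fin k ↪o Fin n) : ℝ :=
  (M.submatrix r c).det

/-- The variety `N_n^+`: unipotent upper triangular matrices all of whose minors are positive,
except those that vanish identically on `N_n`. -/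
def IsTotallyPositive (M : Matrix (Fin n) (Fin n) ℝ) : Prop :=
  IsUnipotentUpper M ∧ ∀ (k : ℕ) (r c : Fin k ↪o Fin n),
    (∃ G : Matrix (Fin n) (Fin n) ℝ, IsUnipotentUpper G ∧ minor G r c ≠ 0) → 0 < minor M r c

/-- The embedding of `Fin k` onto the first `k` elements of `Fin n`. -/
def firstEmb {k : ℕ} (h : k ≤ n) : Fin k ↪o Fin n := Fin.castLEOrderEmb h

/-- The embedding of `Fin k` onto the last `k` elements of `Fin n`. -/
def lastEmb {k : ℕ} (h : k ≤ n) : Fin k ↪o Fin n :=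
  OrderEmbedding.ofStrictMono (fun j => ⟨n - k + j, by omega⟩)
    (fun i j hij => by simp only [Fin.lt_def] at hij ⊢; omega)

/-- The right flag minor `Δ_I`: rows in `I`, last `|I|` columns. -/
def rightFlag (M : Matrix (Fin n) (Fin n) ℝ) (I : Finset (Fin n)) : ℝ :=
  minor M (I.orderEmbOfFin rfl) (lastEmb (card_finset_fin_le I))

/-- The upper flag minor `Δ^J`: first `|J|` rows, columns in `J`. -/
def upperFlag (M : Matrix (Fin n) (Fin n) ℝ) (J : Finset (Fin n)) : ℝ :=
  minor M (firstEmb (card_finset_fin_le J)) (J.orderEmbOfFin rfl)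

/-- The set `[a, b]` of labels: the element `i : Fin n` carries the label `i + 1`, so that the
labels run through `1, …, n`. -/
def seg (n a b : ℕ) : Finset (Fin n) :=
  Finset.univ.filter fun i => a ≤ (i : ℕ) + 1 ∧ (i : ℕ) + 1 ≤ b

/-- The variable `Y_{abc}(M)`, for `1 ≤ a < b < c ≤ n`. -/
def Ylow (a b c : ℕ) (M : Matrix (Fin n) (Fin n) ℝ) : ℝ :=
  (rightFlag M (seg n a (b - 1) ∪ seg n (c + 1) n) * rightFlag M (seg n (a + 1) b ∪ seg n c n)) /
    (rightFlag M (seg n a b ∪ seg n (c + 1) n) * rightFlag M (seg n (a + 1) (b - 1) ∪ seg n c n))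

/-- The variable `Y^{abc}(M)`, for `1 ≤ a < b < c ≤ n`. -/
def Yup (a b c : ℕ) (M : Matrix (Fin n) (Fin n) ℝ) : ℝ :=
  (upperFlag M (seg n a b ∪ seg n (c + 1) n) * upperFlag M (seg n (a + 1) (b - 1) ∪ seg n c n)) /
    (upperFlag M (seg n a (b - 1) ∪ seg n (c + 1) n) * upperFlag M (seg n (a + 1) b ∪ seg n c n))

/-- The permutation matrix `P` with `P_{ij} = δ_{i+j,n+1}` (labels `1, …, n`). -/
def revMatrix (n : ℕ) : Matrix (Fin n) (Fin n) ℝ :=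
  Matrix.of fun i j => if (i : ℕ) + 1 + ((j : ℕ) + 1) = n + 1 then 1 else 0

/-- `P M P = M' P D M''` with `M'`, `M''` unipotent upper triangular and `D = diag d`. -/
def IsGauss (M M' M'' : Matrix (Fin n) (Fin n) ℝ) (d : Fin n → ℝ) : Prop :=
  IsUnipotentUpper M' ∧ IsUnipotentUpper M'' ∧
    revMatrix n * M * revMatrix n = M' * revMatrix n * Matrix.diagonal d * M''

open Classical in
/-- The pair `(M', M'')` determined by `P M P = M' P D M''`. For `M` invertible such a
decomposition is unique when it exists (it is the LDU decomposition of `M P`), and it exists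
for `M` in `N_n^+`; the value at other matrices is irrelevant. -/
def gaussPair (M : Matrix (Fin n) (Fin n) ℝ) :
    Matrix (Fin n) (Fin n) ℝ × Matrix (Fin n) (Fin n) ℝ :=
  if h : ∃ p : Matrix (Fin n) (Fin n) ℝ × Matrix (Fin n) (Fin n) ℝ, ∃ d, IsGauss M p.1 p.2 d
  then h.choose else (1, 1)

/-- The map `M ↦ M'`. -/
def prime (M : Matrix (Fin n) (Fin n) ℝ) : Matrix (Fin n) (Fin n) ℝ := (gaussPair M).1

/-- The map `M ↦ M''`. -/
def dprime (M : Matrix (Fin n) (Fin n) ℝ) : Matrix (Fin n) (Fin n) ℝ := (gaussPair M).2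

/-- The discrete tetrahedron `T_n` of triples `1 ≤ a < b < c ≤ n`. -/
def tetra (n : ℕ) : Finset (ℕ × ℕ × ℕ) :=
  (Finset.Icc 1 n ×ˢ Finset.Icc 1 n ×ˢ Finset.Icc 1 n).filter
    fun t => t.1 < t.2.1 ∧ t.2.1 < t.2.2

end TotPos

end

/-!
The flag minors of a matrix satisfy the three-term Plücker relations, so the ratios
`p (a K) p (bcK) / (p (abK) p (cK))` of neighbouring minors obey the pentagon relation for the
Rogers dilogarithm. Applied to index sets and to their complements it yields a relation between
the eight ratios attached to `a < b < c < d`, and summing it over all quadruples telescopes: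
the ratios over the second and fourth gaps of `a < b < c` have the same dilogarithm sum as those
over the first and third gaps. The Gauss decomposition of `P M P` interchanges the two families
and inverts every ratio, because reversing labels multiplies a flag minor of `M'` or `M''` by a
factor depending only on its size. Hence `l x + l (1 / x) = 1` leaves the number of triples.
-/

noncomputable section

namespace TotPos

open Filter Topology

variable {n : ℕ}

/-! ### The Rogers dilogarithm -/

section Dilogarithm

lemma continuousOn_Li2 : ContinuousOn Li2 (Set.Icc 0 1) := by
  have summable_bound : Summable fun k : ℕ => 1 / ((k : ℝ) + 1) ^ 2 := by
    simpa using (summable_nat_add_iff (f := fun k : ℕ => 1 / (k : ℝ) ^ 2) 1).2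
      (Real.summable_one_div_nat_pow.2 one_lt_two)
  refine continuousOn_tsum (fun k => by fun_prop) summable_bound fun k x hx => ?_
  rw [Real.norm_of_nonneg (by have := hx.1; positivity)]
  gcongr
  exact pow_le_one₀ hx.1 hx.2

lemma Li2_zero : Li2 0 = 0 := by simp [Li2]

lemma Li2_one : Li2 1 = Real.pi ^ 2 / 6 := by
  have h := hasSum_zeta_two
  rw [← hasSum_nat_add_iff' 1] at h
  simpa [Li2] using h.tsum_eq

lemma hasDerivAt_Li2 {x : ℝ} (hx₀ : 0 < x) (hx₁ : x < 1) :
    HasDerivAt Li2 (-Real.log (1 - x) / x) x := by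
  obtain ⟨r, hxr, hr₁⟩ := exists_between hx₁
  have hr₀ : 0 < r := hx₀.trans hxr
  have termwise : HasDerivAt Li2 (∑' k : ℕ, x ^ k / ((k : ℝ) + 1)) x := by
    refine hasDerivAt_tsum_of_isPreconnected (t := Set.Ioo (-r) r) (y₀ := 0)
      (g := fun (k : ℕ) (y : ℝ) => y ^ (k + 1) / ((k : ℝ) + 1) ^ 2)
      (g' := fun (k : ℕ) (y : ℝ) => y ^ k / ((k : ℝ) + 1))
      (summable_geometric_of_lt_one hr₀.le hr₁) isOpen_Ioo isPreconnected_Ioo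
      (fun k y _ => ?_) (fun k y hy => ?_) ⟨?_, hr₀⟩ ?_ ⟨?_, hxr⟩
    · refine ((hasDerivAt_pow (k + 1) y).div_const (((k : ℝ) + 1) ^ 2)).congr_deriv ?_
      push_cast
      field_simp
    · rw [norm_div, norm_pow, Real.norm_eq_abs, Real.norm_of_nonneg (by positivity)]
      calc |y| ^ k / ((k : ℝ) + 1) ≤ |y| ^ k :=
            div_le_self (by positivity) (by linarith [(Nat.cast_nonneg k : (0 : ℝ) ≤ k)])
        _ ≤ r ^ k := by gcongr; exact (abs_lt.2 hy).le
    · linarith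
    · simp
    · linarith
  convert termwise using 1
  have log_series :=
    (Real.hasSum_pow_div_log_of_abs_lt_one (abs_lt.2 ⟨by linarith, hx₁⟩)).div_const x
  rw [← log_series.tsum_eq]
  congr with k
  rw [pow_succ]
  field_simp

lemma continuous_log_mul_log_one_sub :
    Continuous fun x : ℝ => Real.log x * Real.log (1 - x) := by
  have continuousAt_zero : ContinuousAt (fun x : ℝ => Real.log x * Real.log (1 - x)) 0 := by
    have hlog : (fun x : ℝ => Real.log (1 - x)) =O[𝓝 0] fun x => x := by
      simpa using (((hasDerivAt_id (0 : ℝ)).const_sub 1).log (by simp)).isBigO_sub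
    have hmul : Tendsto (fun x : ℝ => Real.log x * x) (𝓝 0) (𝓝 0) := by
      simpa [mul_comm] using Real.continuous_mul_log.tendsto 0
    simpa [ContinuousAt] using ((Asymptotics.isBigO_refl Real.log _).mul hlog).trans_tendsto hmul
  refine continuous_iff_continuousAt.2 fun x => ?_
  rcases eq_or_ne x 0 with rfl | hx₀
  · exact continuousAt_zero
  rcases eq_or_ne x 1 with rfl | hx₁
  · refine (ContinuousAt.comp (f := fun x : ℝ => 1 - x) (x := 1)
      (by simpa using continuousAt_zero) (by fun_prop)).congr (.of_forall fun x => ?_)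
    simp [mul_comm]
  · exact (Real.continuousAt_log hx₀).mul
      (ContinuousAt.log (by fun_prop) (sub_ne_zero.2 hx₁.symm))

-- Since `Real.log 0 = 0`, the junk values of `rogersL` at `0` and `1` are the right limits.
lemma continuousOn_rogersL : ContinuousOn rogersL (Set.Icc 0 1) := by
  refine (continuousOn_Li2.add (continuous_log_mul_log_one_sub.const_smul
    (1 / 2 : ℝ)).continuousOn).congr fun x _ => ?_
  simp [rogersL, mul_assoc]

lemma rogersL_zero : rogersL 0 = 0 := by simp [rogersL, Li2_zero]

lemma rogersL_one : rogersL 1 = Real.pi ^ 2 / 6 := by simp [rogersL, Li2_one]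

lemma hasDerivAt_rogersL {x : ℝ} (hx₀ : 0 < x) (hx₁ : x < 1) :
    HasDerivAt rogersL (-(Real.log (1 - x) / x + Real.log x / (1 - x)) / 2) x := by
  have hx₁' : 1 - x ≠ 0 := by linarith
  have h := (hasDerivAt_Li2 hx₀ hx₁).add (((Real.hasDerivAt_log hx₀.ne').const_mul (1 / 2)).mul
    (((hasDerivAt_id x).const_sub 1).log hx₁'))
  refine h.congr_deriv ?_
  simp only [id]
  field_simp
  ring

lemma eq_of_hasDerivAt_zero {f : ℝ → ℝ} {a b : ℝ} (hab : a ≤ b)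
    (hcont : ContinuousOn f (Set.Icc a b)) (hderiv : ∀ x ∈ Set.Ioo a b, HasDerivAt f 0 x) :
    f b = f a := by
  rcases hab.eq_or_lt with rfl | hlt
  · rfl
  obtain ⟨_, _, hslope⟩ := exists_hasDerivAt_eq_slope f 0 hlt hcont hderiv
  have : (f b - f a) / (b - a) = 0 := hslope.symm
  rwa [div_eq_zero_iff, or_iff_left (sub_pos.2 hlt).ne', sub_eq_zero] at this

lemma rogersL_add_rogersL_one_sub {x : ℝ} (hx : x ∈ Set.Icc (0 : ℝ) 1) :
    rogersL x + rogersL (1 - x) = Real.pi ^ 2 / 6 := by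
  have hcont : ContinuousOn (fun y => rogersL y + rogersL (1 - y)) (Set.Icc 0 x) := by
    refine (continuousOn_rogersL.mono ?_).add
      (continuousOn_rogersL.comp (by fun_prop) fun y hy => ?_)
    · exact Set.Icc_subset_Icc_right hx.2
    · exact ⟨by linarith [hy.2, hx.2], by linarith [hy.1]⟩
  have h := eq_of_hasDerivAt_zero hx.1 hcont fun y hy => by
    have hy₁ : y < 1 := hy.2.trans_le hx.2
    refine ((hasDerivAt_rogersL hy.1 hy₁).add ((hasDerivAt_rogersL (x := 1 - y)
      (by linarith) (by linarith [hy.1])).comp y ((hasDerivAt_id y).const_sub 1))).congr_deriv ?_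
    rw [sub_sub_cancel]
    ring
  simpa [rogersL_zero, rogersL_one] using h

lemma ell_add_ell_inv {x : ℝ} (hx : 0 < x) : ell x + ell x⁻¹ = 1 := by
  have h := rogersL_add_rogersL_one_sub (x := x / (1 + x))
    ⟨by positivity, by rw [div_le_one (by positivity)]; linarith⟩
  have hinv : x⁻¹ / (1 + x⁻¹) = 1 - x / (1 + x) := by field_simp; ring
  rw [ell, ell, hinv, ← mul_add, h]
  field_simp

lemma ell_zero : ell 0 = 0 := by simp [ell, rogersL_zero]

lemma continuousOn_ell : ContinuousOn ell (Set.Ici 0) := by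
  refine continuousOn_const.mul (continuousOn_rogersL.comp
    (ContinuousOn.div (by fun_prop) (by fun_prop) fun x hx => ?_) fun x hx => ?_)
  · have : (0 : ℝ) ≤ x := hx
    positivity
  · have : (0 : ℝ) ≤ x := hx
    exact ⟨by positivity, by rw [div_le_one (by positivity)]; linarith⟩

lemma hasDerivAt_ell {x : ℝ} (hx : 0 < x) :
    HasDerivAt ell (3 / Real.pi ^ 2 * (Real.log (1 + x) / x - Real.log x / (1 + x))) x := by
  have hlt : x / (1 + x) < 1 := by rw [div_lt_one (by positivity)]; linarith
  have hsub : 1 - x / (1 + x) = (1 + x)⁻¹ := by field_simp; ring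
  have h := ((hasDerivAt_rogersL (by positivity) hlt).comp x ((hasDerivAt_id x).div
    ((hasDerivAt_id x).const_add 1) (by positivity))).const_mul (6 / Real.pi ^ 2)
  refine h.congr_deriv ?_
  rw [hsub, Real.log_inv, Real.log_div hx.ne' (by positivity)]
  simp only [id]
  field_simp
  ring

theorem ell_five_term {x y : ℝ} (hx : 0 < x) (hy : 0 < y) :
    ell x + ell y = ell (x * y / (1 + x + y)) + ell (x / (1 + y)) + ell (y / (1 + x)) := by
  let g : ℝ → ℝ := fun t =>
    ell t - ell (t * y / (1 + t + y)) - ell (t / (1 + y)) - ell (y / (1 + t))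
  have hcont : ContinuousOn g (Set.Icc 0 x) := by
    have comp_ell {f : ℝ → ℝ} (hf : ContinuousOn f (Set.Icc 0 x))
        (hpos : ∀ t, 0 ≤ t → 0 ≤ f t) : ContinuousOn (fun t => ell (f t)) (Set.Icc 0 x) :=
      continuousOn_ell.comp hf fun t ht => hpos t ht.1
    refine (((comp_ell continuousOn_id fun t ht => ht).sub (comp_ell ?_ fun t ht => ?_)).sub
      (comp_ell (by fun_prop) fun t ht => ?_)).sub (comp_ell ?_ fun t ht => ?_)
    any_goals positivity
    all_goals refine ContinuousOn.div (by fun_prop) (by fun_prop) fun t ht => ?_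
    all_goals have := ht.1; positivity
  have hderiv (t : ℝ) (ht : t ∈ Set.Ioo 0 x) : HasDerivAt g 0 t := by
    have ht₀ : 0 < t := ht.1
    have hid := hasDerivAt_id t
    have d₁ := (hasDerivAt_ell (x := t * y / (1 + t + y)) (by positivity)).comp t
      ((hid.mul_const y).div ((hid.const_add 1).add_const y) (by positivity))
    have d₂ := (hasDerivAt_ell (x := t / (1 + y)) (by positivity)).comp t (hid.div_const (1 + y))
    have d₃ := (hasDerivAt_ell (x := y / (1 + t)) (by positivity)).comp t
      ((hasDerivAt_const t y).div (hid.const_add 1) (by positivity))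
    have e₁ : 1 + t * y / (1 + t + y) = (1 + t) * (1 + y) / (1 + t + y) := by field_simp; ring
    have e₂ : 1 + t / (1 + y) = (1 + t + y) / (1 + y) := by field_simp; ring
    have e₃ : 1 + y / (1 + t) = (1 + t + y) / (1 + t) := by field_simp
    have hyt : y ≠ 0 ∧ t ≠ 0 ∧ 1 + t ≠ 0 ∧ 1 + y ≠ 0 ∧ 1 + t + y ≠ 0 := by
      refine ⟨?_, ?_, ?_, ?_, ?_⟩ <;> positivity
    obtain ⟨hy₀, ht₀', h1t, h1y, h1ty⟩ := hyt
    refine ((((hasDerivAt_ell ht₀).sub d₁).sub d₂).sub d₃).congr_deriv ?_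
    simp only [id, e₁, e₂, e₃]
    simp only [Real.log_div, Real.log_mul, ne_eq, mul_eq_zero, not_false_eq_true, or_self, *]
    field_simp
    ring
  have h : g x = g 0 := eq_of_hasDerivAt_zero hx.le hcont hderiv
  simp only [g, ell_zero, zero_mul, zero_div, add_zero, div_one] at h
  linarith

end Dilogarithm

/-! ### Exchange ratios of positive solutions of the three-term Plücker relations -/

section PluckerPositive

variable {ι : Type*} [LinearOrder ι] {p : Finset ι → ℝ} {a b c d : ι} {K : Finset ι}

/-- A positive function of finite subsets satisfying the incidence Plücker relations between
subsets of adjacent cardinalities, i.e. what remains of the Plücker coordinates of a totally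
positive flag when the flag itself is forgotten. -/
structure IsPluckerPositive (p : Finset ι → ℝ) : Prop where
  pos : ∀ S, 0 < p S
  three_term : ∀ {a b c : ι} {K : Finset ι}, a < b → b < c → a ∉ K → b ∉ K → c ∉ K →
    p (insert b K) * p (insert a (insert c K)) =
      p (insert a K) * p (insert b (insert c K)) + p (insert a (insert b K)) * p (insert c K)

/-- The ratio of the two terms on the right of the three-term Plücker relation at `a, b, c`
over `K`. The variables `Y_{abc}` and `1 / Y^{abc}` are such ratios. -/
def exchangeRatio (p : Finset ι → ℝ) (a b c : ι) (K : Finset ι) : ℝ :=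
  p (insert a K) * p (insert b (insert c K)) / (p (insert a (insert b K)) * p (insert c K))

/-- The cross-ratio of `a, b, c, d` over `K`, invariant under complementing all index sets. -/
def crossRatio (p : Finset ι → ℝ) (a b c d : ι) (K : Finset ι) : ℝ :=
  p (insert a (insert b K)) * p (insert c (insert d K)) /
    (p (insert b (insert c K)) * p (insert a (insert d K)))

namespace IsPluckerPositive

lemma exchangeRatio_pos (hp : IsPluckerPositive p) (a b c : ι) (K : Finset ι) :
    0 < exchangeRatio p a b c K :=
  div_pos (mul_pos (hp.pos _) (hp.pos _)) (mul_pos (hp.pos _) (hp.pos _))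

lemma one_add_exchangeRatio (hp : IsPluckerPositive p) (hab : a < b) (hbc : b < c) (ha : a ∉ K)
    (hb : b ∉ K) (hc : c ∉ K) :
    1 + exchangeRatio p a b c K = p (insert b K) * p (insert a (insert c K)) /
      (p (insert a (insert b K)) * p (insert c K)) := by
  have hden : p (insert a (insert b K)) * p (insert c K) ≠ 0 :=
    (mul_pos (hp.pos _) (hp.pos _)).ne'
  rw [exchangeRatio, one_add_div hden, hp.three_term hab hbc ha hb hc, add_comm]

-- Up to inversion, the five arguments of `ell` form a period of the `A₂` Y-system.
lemma ell_exchangeRatio_pentagon (hp : IsPluckerPositive p) (hab : a < b) (hbc : b < c)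
    (hcd : c < d) (ha : a ∉ K) (hb : b ∉ K) (hc : c ∉ K) (hd : d ∉ K) :
    ell (exchangeRatio p a b d K) + ell (exchangeRatio p b c d K) =
      ell (exchangeRatio p a c d K) + ell (exchangeRatio p a b c K) +
        ell (crossRatio p a b c d K) := by
  have hne S : p S ≠ 0 := (hp.pos S).ne'
  have h_abd := hp.one_add_exchangeRatio hab (hbc.trans hcd) ha hb hd
  have h_bcd := hp.one_add_exchangeRatio hbc hcd hb hc hd
  have h_acd := hp.one_add_exchangeRatio (hab.trans hbc) hcd ha hc hd
  have h_ac : exchangeRatio p a b d K * exchangeRatio p b c d K /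
      (1 + exchangeRatio p a b d K + exchangeRatio p b c d K) = exchangeRatio p a c d K := by
    have h : exchangeRatio p a c d K * ((1 + exchangeRatio p a b d K) *
        (1 + exchangeRatio p b c d K)) =
        exchangeRatio p a b d K * exchangeRatio p b c d K * (1 + exchangeRatio p a c d K) := by
      rw [h_abd, h_bcd, h_acd]
      simp only [exchangeRatio]
      field_simp [hne]
    have := hp.exchangeRatio_pos a b d K
    have := hp.exchangeRatio_pos b c d K
    rw [div_eq_iff (by positivity)]
    linear_combination -h
  have h_bd : exchangeRatio p a b d K / (1 + exchangeRatio p b c d K) =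
      exchangeRatio p a b c K := by
    rw [h_bcd, exchangeRatio, exchangeRatio]
    field_simp [hne]
  have h_cr : exchangeRatio p b c d K / (1 + exchangeRatio p a b d K) =
      crossRatio p a b c d K := by
    rw [h_abd, exchangeRatio, crossRatio]
    field_simp [hne]
  rw [ell_five_term (hp.exchangeRatio_pos a b d K) (hp.exchangeRatio_pos b c d K), h_ac, h_bd, h_cr]

lemma compl [Fintype ι] (hp : IsPluckerPositive p) : IsPluckerPositive fun S => p Sᶜ where
  pos S := hp.pos Sᶜ
  three_term {a b c K} hab hbc ha hb hc := by
    have ⟨hab', hac', hbc'⟩ : a ≠ b ∧ a ≠ c ∧ b ≠ c := ⟨hab.ne, (hab.trans hbc).ne, hbc.ne⟩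
    obtain ⟨K', hK'⟩ : ∃ K', K' = (insert a (insert b (insert c K)))ᶜ := ⟨_, rfl⟩
    have ⟨ha', hb', hc'⟩ : a ∉ K' ∧ b ∉ K' ∧ c ∉ K' := by grind [Finset.mem_compl]
    have h := hp.three_term hab hbc ha' hb' hc'
    have e_a : (insert a K)ᶜ = insert b (insert c K') := by grind [Finset.mem_compl]
    have e_b : (insert b K)ᶜ = insert a (insert c K') := by grind [Finset.mem_compl]
    have e_c : (insert c K)ᶜ = insert a (insert b K') := by grind [Finset.mem_compl]
    have e_bc : (insert b (insert c K))ᶜ = insert a K' := by grind [Finset.mem_compl]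
    have e_ac : (insert a (insert c K))ᶜ = insert b K' := by grind [Finset.mem_compl]
    have e_ab : (insert a (insert b K))ᶜ = insert c K' := by grind [Finset.mem_compl]
    rw [e_a, e_b, e_c, e_bc, e_ac, e_ab]
    linarith

lemma exchangeRatio_compl [Fintype ι] (p : Finset ι → ℝ) {K' : Finset ι} (hab : a ≠ b) (hac : a ≠ c)
    (hbc : b ≠ c) (ha : a ∉ K) (hb : b ∉ K) (hc : c ∉ K)
    (hK' : K' = (insert a (insert b (insert c K)))ᶜ) :
    exchangeRatio (fun S => p Sᶜ) a b c K = exchangeRatio p a b c K' := by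
  have e₁ : (insert a K)ᶜ = insert b (insert c K') := by grind [Finset.mem_compl]
  have e₂ : (insert b (insert c K))ᶜ = insert a K' := by grind [Finset.mem_compl]
  have e₃ : (insert a (insert b K))ᶜ = insert c K' := by grind [Finset.mem_compl]
  have e₄ : (insert c K)ᶜ = insert a (insert b K') := by grind [Finset.mem_compl]
  rw [exchangeRatio, exchangeRatio, e₁, e₂, e₃, e₄]
  ring

lemma ell_exchangeRatio_eight_term [Finite ι] (hp : IsPluckerPositive p) (hab : a < b) (hbc : b < c)
    (hcd : c < d) (ha : a ∉ K) (hb : b ∉ K) (hc : c ∉ K) (hd : d ∉ K) :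
    ell (exchangeRatio p a b c (insert d K)) - ell (exchangeRatio p a b c K) +
        (ell (exchangeRatio p a c d (insert b K)) - ell (exchangeRatio p a c d K)) =
      ell (exchangeRatio p a b d (insert c K)) - ell (exchangeRatio p a b d K) +
        (ell (exchangeRatio p b c d (insert a K)) - ell (exchangeRatio p b c d K)) := by
  cases nonempty_fintype ι
  have ⟨hac, hbd⟩ := And.intro (hab.trans hbc) (hbc.trans hcd)
  have hne : a ≠ b ∧ a ≠ c ∧ a ≠ d ∧ b ≠ c ∧ b ≠ d ∧ c ≠ d :=
    ⟨hab.ne, hac.ne, (hac.trans hcd).ne, hbc.ne, hbd.ne, hcd.ne⟩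
  obtain ⟨K', hK'⟩ : ∃ K', K' = (insert a (insert b (insert c (insert d K))))ᶜ := ⟨_, rfl⟩
  have h_abd : exchangeRatio (fun S => p Sᶜ) a b d K' = exchangeRatio p a b d (insert c K) := by
    apply exchangeRatio_compl <;> grind (gen := 12) [Finset.mem_compl]
  have h_bcd : exchangeRatio (fun S => p Sᶜ) b c d K' = exchangeRatio p b c d (insert a K) := by
    apply exchangeRatio_compl <;> grind (gen := 12) [Finset.mem_compl]
  have h_acd : exchangeRatio (fun S => p Sᶜ) a c d K' = exchangeRatio p a c d (insert b K) := by
    apply exchangeRatio_compl <;> grind (gen := 12) [Finset.mem_compl]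
  have h_abc : exchangeRatio (fun S => p Sᶜ) a b c K' = exchangeRatio p a b c (insert d K) := by
    apply exchangeRatio_compl <;> grind (gen := 12) [Finset.mem_compl]
  have h_cr : crossRatio (fun S => p Sᶜ) a b c d K' = crossRatio p a b c d K := by
    have e₁ : (insert a (insert b K'))ᶜ = insert c (insert d K) := by
      grind (gen := 12) [Finset.mem_compl]
    have e₂ : (insert c (insert d K'))ᶜ = insert a (insert b K) := by
      grind (gen := 12) [Finset.mem_compl]
    have e₃ : (insert b (insert c K'))ᶜ = insert a (insert d K) := by
      grind (gen := 12) [Finset.mem_compl]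
    have e₄ : (insert a (insert d K'))ᶜ = insert b (insert c K) := by
      grind (gen := 12) [Finset.mem_compl]
    rw [crossRatio, crossRatio, e₁, e₂, e₃, e₄]
    ring
  have primal := hp.ell_exchangeRatio_pentagon hab hbc hcd ha hb hc hd
  have ⟨ha', hb', hc', hd'⟩ : a ∉ K' ∧ b ∉ K' ∧ c ∉ K' ∧ d ∉ K' := by
    grind (gen := 12) [Finset.mem_compl]
  have dual := hp.compl.ell_exchangeRatio_pentagon hab hbc hcd ha' hb' hc' hd'
  rw [h_abd, h_bcd, h_acd, h_abc, h_cr] at dual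
  linarith

end IsPluckerPositive

end PluckerPositive

section Telescoping

variable {ι G : Type*} [LinearOrder ι] [AddCommGroup G]

lemma sum_insert_lt_sub (F : Finset ι → G) (S : Finset ι) :
    ∑ e ∈ S, (F (insert e {x ∈ S | x < e}) - F {x ∈ S | x < e}) = F S - F ∅ := by
  induction S using Finset.induction_on_max with
  | empty => simp
  | insert m S hm ih =>
    have hmS : m ∉ S := fun h => (hm m h).false
    have filter_max : {x ∈ insert m S | x < m} = S := by grind
    have filter_lt : ∀ e ∈ S, {x ∈ insert m S | x < e} = {x ∈ S | x < e} := by grind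
    rw [Finset.sum_insert hmS, filter_max,
      Finset.sum_congr rfl fun e he => by rw [filter_lt e he], ih]
    abel

lemma sum_insert_lt_sub_of_eq {B S : Finset ι} {E : ι → Finset ι} (F : Finset ι → G)
    (hE : ∀ e ∈ S, E e = B ∪ {x ∈ S | x < e}) :
    ∑ e ∈ S, (F (insert e (E e)) - F (E e)) = F (B ∪ S) - F B := by
  have h := sum_insert_lt_sub (fun T => F (B ∪ T)) S
  rw [Finset.union_empty] at h
  rw [← h]
  exact Finset.sum_congr rfl fun e he => by rw [hE e he, Finset.union_insert]

lemma sum_insert_gt_sub_of_eq {B S : Finset ι} {E : ι → Finset ι} (F : Finset ι → G)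
    (hE : ∀ e ∈ S, E e = B ∪ {x ∈ S | e < x}) :
    ∑ e ∈ S, (F (insert e (E e)) - F (E e)) = F (B ∪ S) - F B :=
  sum_insert_lt_sub_of_eq (ι := ιᵒᵈ) F hE

end Telescoping

section Gaps

variable {ι G : Type*} [LinearOrder ι] [Fintype ι] [AddCommGroup G]

/-- The increasing triples in `ι`. -/
def triples (ι : Type*) [LinearOrder ι] [Fintype ι] : Finset (ι × ι × ι) :=
  {t | t.1 < t.2.1 ∧ t.2.1 < t.2.2}

/-- The increasing quadruples in `ι`. -/
def quadruples (ι : Type*) [LinearOrder ι] [Fintype ι] : Finset (ι × ι × ι × ι) :=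
  {q | q.1 < q.2.1 ∧ q.2.1 < q.2.2.1 ∧ q.2.2.1 < q.2.2.2}

/-- The open interval `(a, b)`. -/
def gap (a b : ι) : Finset ι := {x | a < x ∧ x < b}

/-- The union of the second and the last of the four gaps cut out by `a < b < c`. -/
def oddGaps (a b c : ι) : Finset ι := {x | (a < x ∧ x < b) ∨ c < x}

/-- The union of the first and the third of the four gaps cut out by `a < b < c`. -/
def evenGaps (a b c : ι) : Finset ι := {x | x < a ∨ (b < x ∧ x < c)}

lemma sum_quadruples_eq_sum_last (f : ι → ι → ι → ι → G) :
    ∑ q ∈ quadruples ι, f q.1 q.2.1 q.2.2.1 q.2.2.2 =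
      ∑ t ∈ triples ι, ∑ d with t.2.2 < d, f t.1 t.2.1 t.2.2 d := by
  rw [Finset.sum_sigma']
  exact Finset.sum_nbij' (fun q => ⟨(q.1, q.2.1, q.2.2.1), q.2.2.2⟩)
    (fun s => (s.1.1, s.1.2.1, s.1.2.2, s.2)) (by grind [quadruples, triples])
    (by grind [quadruples, triples]) (by grind) (by grind) (by grind)

lemma sum_quadruples_eq_sum_third (f : ι → ι → ι → ι → G) :
    ∑ q ∈ quadruples ι, f q.1 q.2.1 q.2.2.1 q.2.2.2 =
      ∑ t ∈ triples ι, ∑ c ∈ gap t.2.1 t.2.2, f t.1 t.2.1 c t.2.2 := by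
  rw [Finset.sum_sigma']
  exact Finset.sum_nbij' (fun q => ⟨(q.1, q.2.1, q.2.2.2), q.2.2.1⟩)
    (fun s => (s.1.1, s.1.2.1, s.2, s.1.2.2)) (by grind [quadruples, triples, gap])
    (by grind [quadruples, triples, gap]) (by grind) (by grind) (by grind)

lemma sum_quadruples_eq_sum_second (f : ι → ι → ι → ι → G) :
    ∑ q ∈ quadruples ι, f q.1 q.2.1 q.2.2.1 q.2.2.2 =
      ∑ t ∈ triples ι, ∑ b ∈ gap t.1 t.2.1, f t.1 b t.2.1 t.2.2 := by
  rw [Finset.sum_sigma']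
  exact Finset.sum_nbij' (fun q => ⟨(q.1, q.2.2.1, q.2.2.2), q.2.1⟩)
    (fun s => (s.1.1, s.2, s.1.2.1, s.1.2.2)) (by grind [quadruples, triples, gap])
    (by grind [quadruples, triples, gap]) (by grind) (by grind) (by grind)

lemma sum_quadruples_eq_sum_first (f : ι → ι → ι → ι → G) :
    ∑ q ∈ quadruples ι, f q.1 q.2.1 q.2.2.1 q.2.2.2 =
      ∑ t ∈ triples ι, ∑ a with a < t.1, f a t.1 t.2.1 t.2.2 := by
  rw [Finset.sum_sigma']
  exact Finset.sum_nbij' (fun q => ⟨(q.2.1, q.2.2.1, q.2.2.2), q.1⟩)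
    (fun s => (s.2, s.1.1, s.1.2.1, s.1.2.2)) (by grind [quadruples, triples])
    (by grind [quadruples, triples]) (by grind) (by grind) (by grind)

lemma sum_insert_gap_sub (F : Finset ι → G) (i j k : ι) :
    ∑ d with k < d, (F (insert d (gap i j ∪ gap k d)) - F (gap i j ∪ gap k d)) +
        ∑ b ∈ gap i j, (F (insert b (gap i b ∪ gap j k)) - F (gap i b ∪ gap j k)) -
      (∑ c ∈ gap j k, (F (insert c (gap i j ∪ gap c k)) - F (gap i j ∪ gap c k)) +
        ∑ a with a < i, (F (insert a (gap a i ∪ gap j k)) - F (gap a i ∪ gap j k))) =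
      F (oddGaps i j k) - F (evenGaps i j k) := by
  have last : ∑ d with k < d, (F (insert d (gap i j ∪ gap k d)) - F (gap i j ∪ gap k d)) =
      F (oddGaps i j k) - F (gap i j) := by
    rw [sum_insert_lt_sub_of_eq (B := gap i j) F (by grind [gap])]
    congr
    grind [gap, oddGaps]
  have third : ∑ c ∈ gap j k, (F (insert c (gap i j ∪ gap c k)) - F (gap i j ∪ gap c k)) =
      F (gap i j ∪ gap j k) - F (gap i j) :=
    sum_insert_gt_sub_of_eq F (by grind [gap])
  have second : ∑ b ∈ gap i j, (F (insert b (gap i b ∪ gap j k)) - F (gap i b ∪ gap j k)) =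
      F (gap i j ∪ gap j k) - F (gap j k) := by
    rw [Finset.union_comm (gap i j)]
    exact sum_insert_lt_sub_of_eq F (by grind [gap])
  have first : ∑ a with a < i, (F (insert a (gap a i ∪ gap j k)) - F (gap a i ∪ gap j k)) =
      F (evenGaps i j k) - F (gap j k) := by
    rw [sum_insert_gt_sub_of_eq (B := gap j k) F (by grind [gap])]
    congr
    grind [gap, evenGaps]
  rw [last, third, second, first]
  abel

theorem sum_oddGaps_eq_sum_evenGaps {F : ι → ι → ι → Finset ι → G}
    (hF : ∀ {a b c d K}, a < b → b < c → c < d → a ∉ K → b ∉ K → c ∉ K → d ∉ K →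
      F a b c (insert d K) - F a b c K + (F a c d (insert b K) - F a c d K) =
        F a b d (insert c K) - F a b d K + (F b c d (insert a K) - F b c d K)) :
    ∑ t ∈ triples ι, F t.1 t.2.1 t.2.2 (oddGaps t.1 t.2.1 t.2.2) =
      ∑ t ∈ triples ι, F t.1 t.2.1 t.2.2 (evenGaps t.1 t.2.1 t.2.2) := by
  let K (a b c d : ι) : Finset ι := gap a b ∪ gap c d
  have eight_term := Finset.sum_congr rfl fun (q : ι × ι × ι × ι) (hq : q ∈ quadruples ι) =>
    hF (a := q.1) (b := q.2.1) (c := q.2.2.1) (d := q.2.2.2) (K := K q.1 q.2.1 q.2.2.1 q.2.2.2)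
      (by grind [quadruples]) (by grind [quadruples]) (by grind [quadruples])
      (by grind [gap, quadruples]) (by grind [gap, quadruples])
      (by grind [gap, quadruples]) (by grind [gap, quadruples])
  simp only [Finset.sum_add_distrib] at eight_term
  rw [sum_quadruples_eq_sum_last
      fun a b c d => F a b c (insert d (K a b c d)) - F a b c (K a b c d),
    sum_quadruples_eq_sum_third
      fun a b c d => F a b d (insert c (K a b c d)) - F a b d (K a b c d),
    sum_quadruples_eq_sum_second
      fun a b c d => F a c d (insert b (K a b c d)) - F a c d (K a b c d),
    sum_quadruples_eq_sum_first
      fun a b c d => F b c d (insert a (K a b c d)) - F b c d (K a b c d),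
    ← Finset.sum_add_distrib, ← Finset.sum_add_distrib] at eight_term
  rw [← sub_eq_zero, ← Finset.sum_sub_distrib] at eight_term ⊢
  rw [← eight_term]
  exact Finset.sum_congr rfl fun t _ => (sum_insert_gap_sub (F t.1 t.2.1 t.2.2) _ _ _).symm

end Gaps

/-! ### Flag minors -/

section ThreeTerm

open Matrix

variable {R ι : Type*} [CommRing R]

lemma det_vecCons_vecMul {m : ℕ} (v : Fin m → R) (A : Matrix (Fin m) (Fin (m + 1)) R) :
    (Matrix.of (vecCons (v ᵥ* A) fun i => A i)).det = 0 := by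
  have h := det_updateRow_sum (Matrix.of (vecCons 0 fun i => A i)) 0 (vecCons 0 v)
  convert h using 2
  · ext i j
    cases i using Fin.cases <;>
      simp [vecMul, dotProduct, Fin.sum_univ_succ (n := m), Finset.sum_apply]
  · simp

lemma exists_vecMul_eq_det_vecCons {k : ℕ} (B : Matrix (Fin (k + 2)) ι R) (K : Fin k → ι) :
    ∃ v, v ᵥ* B = fun x => (B.submatrix Fin.castSucc (vecCons x K)).det := by
  let v (i : Fin (k + 1)) : R :=
    (-1) ^ (i : ℕ) * (B.submatrix (Fin.castSucc ∘ i.succAbove) K).det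
  refine ⟨(Fin.snoc v 0 : Fin (k + 2) → R), funext fun x => ?_⟩
  simp only [v, det_succ_column_zero, vecMul, dotProduct, Fin.sum_univ_castSucc (n := k + 1),
    Fin.snoc_castSucc, Fin.snoc_last, zero_mul, add_zero]
  exact Finset.sum_congr rfl fun i _ => mul_right_comm _ _ _

lemma det_three_term {k : ℕ} (B : Matrix (Fin (k + 2)) ι R) (a b c : ι) (K : Fin k → ι) :
    (B.submatrix Fin.castSucc (vecCons b K)).det *
        (B.submatrix id (vecCons a (vecCons c K))).det =
      (B.submatrix Fin.castSucc (vecCons a K)).det *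
          (B.submatrix id (vecCons b (vecCons c K))).det +
        (B.submatrix id (vecCons a (vecCons b K))).det *
          (B.submatrix Fin.castSucc (vecCons c K)).det := by
  let φ (x : ι) : R := (B.submatrix Fin.castSucc (vecCons x K)).det
  let w : Fin (k + 3) → ι := vecCons a (vecCons b (vecCons c K))
  have φ_K (j : Fin k) : φ (K j) = 0 :=
    det_zero_of_column_eq (Fin.succ_ne_zero j).symm fun i => by simp
  have bordered_det : (Matrix.of (vecCons (φ ∘ w) fun i => B.submatrix id w i)).det = 0 := by
    obtain ⟨v, hv⟩ := exists_vecMul_eq_det_vecCons B K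
    have φ_w : φ ∘ w = v ᵥ* B.submatrix id w := funext fun j => (congrFun hv (w j)).symm
    rw [φ_w, det_vecCons_vecMul]
  have w_zero : w ∘ Fin.succAbove 0 = vecCons b (vecCons c K) := rfl
  have w_one : w ∘ (Fin.succ 0).succAbove = vecCons a (vecCons c K) := by
    ext j
    cases j using Fin.cases <;> rfl
  have w_two : w ∘ (Fin.succ (Fin.succ 0)).succAbove = vecCons a (vecCons b K) := by
    ext j
    cases j using Fin.cases with
    | zero => rfl
    | succ j => cases j using Fin.cases <;> rfl
  have cofactor (j : Fin (k + 3)) :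
      (Matrix.of (vecCons (φ ∘ w) fun i => B.submatrix id w i)).submatrix Fin.succ j.succAbove =
        B.submatrix id (w ∘ j.succAbove) := rfl
  have expansion : φ a * (B.submatrix id (vecCons b (vecCons c K))).det +
      (-(φ b * (B.submatrix id (vecCons a (vecCons c K))).det) +
        φ c * (B.submatrix id (vecCons a (vecCons b K))).det) = 0 := by
    rw [det_succ_row_zero, Fin.sum_univ_succ, Fin.sum_univ_succ,
      Fin.sum_univ_succ] at bordered_det
    simp only [cofactor, w_zero, w_one, w_two, Fin.val_succ] at bordered_det
    simpa [w, φ_K] using bordered_det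
  linear_combination -expansion

end ThreeTerm

section OrderSign

open Matrix

variable {ι : Type*} [LinearOrder ι] {k : ℕ}

/-- The sign of a sequence without repetitions, counting its inversions: the sign of the
permutation that sorts it. -/
def orderSign (w : Fin k → ι) : ℤˣ :=
  ∏ i, ∏ j ∈ Finset.Ioi i, if w i < w j then 1 else -1

lemma orderSign_comp_perm {w : Fin k → ι} (hw : StrictMono w) (σ : Equiv.Perm (Fin k)) :
    orderSign (w ∘ σ) = Equiv.Perm.sign σ := by
  simp only [orderSign, σ.sign_eq_prod_prod_Ioi, Function.comp_apply, hw.lt_iff_lt]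

lemma orderSign_of_strictMono {w : Fin k → ι} (hw : StrictMono w) : orderSign w = 1 := by
  simpa using orderSign_comp_perm hw 1

lemma orderSign_of_strictAnti {w : Fin k → ι} (hw : StrictAnti w) :
    orderSign w = orderSign (Fin.rev : Fin k → Fin k) := by
  simp only [orderSign, hw.lt_iff_gt, Fin.rev_strictAnti.lt_iff_gt]

lemma orderSign_vecCons (x : ι) (w : Fin k → ι) :
    orderSign (vecCons x w) = (∏ j, if x < w j then 1 else -1) * orderSign w := by
  simp [orderSign, Fin.prod_univ_succ]

lemma exists_perm_of_injective {w : Fin k → ι} (hw : Function.Injective w) {S : Finset ι}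
    (hS : (S : Set ι) = Set.range w) (h : S.card = k) :
    ∃ σ : Equiv.Perm (Fin k), w = S.orderEmbOfFin h ∘ σ := by
  have hwS j : w j ∈ S := Finset.mem_coe.mp (hS ▸ Set.mem_range_self j)
  let f (j : Fin k) : Fin k := (S.orderIsoOfFin h).symm ⟨w j, hwS j⟩
  have hf : Function.Injective f := fun i j hij => hw (by simpa [f] using hij)
  refine ⟨Equiv.ofBijective f (Finite.injective_iff_bijective.mp hf), funext fun j => ?_⟩
  simp [f, ← Finset.coe_orderIsoOfFin_apply]

lemma det_submatrix_eq_orderSign_mul {R κ : Type*} [CommRing R] (A : Matrix κ ι R)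
    (r : Fin k → κ) {w : Fin k → ι} (hw : Function.Injective w) {S : Finset ι}
    (hS : (S : Set ι) = Set.range w) (h : S.card = k) :
    (A.submatrix r w).det = orderSign w * (A.submatrix r (S.orderEmbOfFin h)).det := by
  obtain ⟨σ, hσ⟩ := exists_perm_of_injective hw hS h
  rw [hσ, orderSign_comp_perm (S.orderEmbOfFin h).strictMono, ← det_permute', submatrix_submatrix]
  rfl

end OrderSign

section Flag

open Matrix

lemma upperFlag_eq_orderSign_mul {k : ℕ} (A : Matrix (Fin n) (Fin n) ℝ) (hk : k ≤ n)
    {w : Fin k → Fin n} (hw : Function.Injective w) {S : Finset (Fin n)}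
    (hS : (S : Set (Fin n)) = Set.range w) :
    upperFlag A S = orderSign w * (A.submatrix (Fin.castLE hk) w).det := by
  obtain rfl : S.card = k := by
    rw [← Set.ncard_coe_finset, hS, Set.ncard_range_of_injective hw, Nat.card_eq_fintype_card,
      Fintype.card_fin]
  rw [det_submatrix_eq_orderSign_mul A _ hw hS rfl, ← mul_assoc, ← Int.cast_mul,
    ← Units.val_mul, Int.units_mul_self, Units.val_one, Int.cast_one, one_mul]
  rfl

lemma upperFlag_three_term (A : Matrix (Fin n) (Fin n) ℝ) {a b c : Fin n} {K : Finset (Fin n)}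
    (hab : a < b) (hbc : b < c) (ha : a ∉ K) (hb : b ∉ K) (hc : c ∉ K) :
    upperFlag A (insert b K) * upperFlag A (insert a (insert c K)) =
      upperFlag A (insert a K) * upperFlag A (insert b (insert c K)) +
        upperFlag A (insert a (insert b K)) * upperFlag A (insert c K) := by
  obtain ⟨k, hk⟩ : ∃ k, K.card = k := ⟨_, rfl⟩
  have hkn : k + 2 ≤ n := by
    have h := Finset.card_le_univ (insert a (insert b (insert c K)))
    rw [Finset.card_insert_of_notMem (by grind), Finset.card_insert_of_notMem (by grind),
      Finset.card_insert_of_notMem hc, hk, Fintype.card_fin] at h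
    omega
  let w := K.orderEmbOfFin hk
  have range_w : Set.range w = K := K.range_orderEmbOfFin hk
  let s (x : Fin n) : ℤˣ := ∏ j, if x < w j then 1 else -1
  let B := A.submatrix (Fin.castLE hkn) id
  have inj {x} (hx : x ∉ K) : Function.Injective (vecCons x w) :=
    Fin.cons_injective_iff.mpr ⟨by simpa [range_w] using hx, w.injective⟩
  have flag_insert {x} (hx : x ∉ K) : upperFlag A (insert x K) =
      s x * (B.submatrix Fin.castSucc (vecCons x w)).det := by
    rw [upperFlag_eq_orderSign_mul A ((Nat.le_succ _).trans hkn) (inj hx) (by simp [range_w]),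
      orderSign_vecCons, orderSign_of_strictMono w.strictMono, mul_one]
    rfl
  have flag_insert_insert {x y} (hxy : x < y) (hx : x ∉ K) (hy : y ∉ K) :
      upperFlag A (insert x (insert y K)) =
        s x * s y * (B.submatrix id (vecCons x (vecCons y w))).det := by
    have inj₂ : Function.Injective (vecCons x (vecCons y w)) :=
      Fin.cons_injective_iff.mpr ⟨by simpa [range_w, hxy.ne] using hx, inj hy⟩
    rw [upperFlag_eq_orderSign_mul A hkn inj₂ (by simp [range_w, Set.insert_comm]),
      orderSign_vecCons, orderSign_vecCons,
      orderSign_of_strictMono w.strictMono, mul_one, Fin.prod_univ_succ]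
    simp only [cons_val_zero, cons_val_succ, hxy, if_true, one_mul, Units.val_mul, Int.cast_mul]
    rfl
  rw [flag_insert ha, flag_insert hb, flag_insert hc, flag_insert_insert hab ha hb,
    flag_insert_insert hbc hb hc, flag_insert_insert (hab.trans hbc) ha hc]
  linear_combination (s a * s b * s c : ℝ) * det_three_term B a b c w

lemma upperFlag_lower_mul {L : Matrix (Fin n) (Fin n) ℝ} (hL : L.IsLowerTriangular)
    (A : Matrix (Fin n) (Fin n) ℝ) (S : Finset (Fin n)) :
    upperFlag (L * A) S = (∏ i ∈ {i : Fin n | (i : ℕ) < S.card}, L i i) * upperFlag A S := by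
  have hS := card_finset_fin_le S
  have leading_det : (L.submatrix (Fin.castLE hS) (Fin.castLE hS)).det =
      ∏ i ∈ {i : Fin n | (i : ℕ) < S.card}, L i i := by
    have lower : (L.submatrix (Fin.castLE hS) (Fin.castLE hS)).IsLowerTriangular :=
      fun i j hij => hL hij
    rw [det_of_isLowerTriangular _ lower]
    exact Finset.prod_nbij (Fin.castLE hS) (by simp) (Fin.castLE_injective hS).injOn
      (fun i hi => ⟨⟨i, by simpa using hi⟩, by simp⟩) fun _ _ => rfl
  have leading_rows : (L * A).submatrix (Fin.castLE hS) (S.orderEmbOfFin rfl) =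
      L.submatrix (Fin.castLE hS) (Fin.castLE hS) *
        A.submatrix (Fin.castLE hS) (S.orderEmbOfFin rfl) := by
    ext i j
    refine (Fintype.sum_of_injective _ (Fin.castLE_injective hS) _ _ (fun l hl => ?_)
      fun l => rfl).symm
    have hil : Fin.castLE hS i < l := by
      have : ¬ (l : ℕ) < S.card := by simpa [Fin.range_castLE] using hl
      simp only [Fin.lt_def, Fin.val_castLE]
      omega
    exact mul_eq_zero_of_left (hL hil) _
  rw [← leading_det, upperFlag, minor, upperFlag, minor, ← det_mul]
  exact congrArg det leading_rows

lemma upperFlag_image_rev (A : Matrix (Fin n) (Fin n) ℝ) (S : Finset (Fin n)) :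
    upperFlag A (S.image Fin.rev) =
      orderSign (Fin.rev : Fin S.card → Fin S.card) * upperFlag (A.submatrix id Fin.rev) S := by
  have anti : StrictAnti (Fin.rev ∘ S.orderEmbOfFin rfl) :=
    Fin.rev_strictAnti.comp_strictMono (S.orderEmbOfFin rfl).strictMono
  rw [upperFlag_eq_orderSign_mul A (card_finset_fin_le S) anti.injective
    (by simp [Set.range_comp]), orderSign_of_strictAnti anti]
  rfl

lemma rightFlag_eq_orderSign_mul (M : Matrix (Fin n) (Fin n) ℝ) (S : Finset (Fin n)) :
    rightFlag M S =
      orderSign (Fin.rev : Fin S.card → Fin S.card) * upperFlag (Mᵀ.submatrix Fin.rev id) S := by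
  have lastEmb_eq : ⇑(lastEmb (card_finset_fin_le S)) =
      Fin.rev ∘ Fin.castLE (card_finset_fin_le S) ∘ Fin.rev := by
    ext j
    change n - S.card + j = n - (S.card - (j + 1) + 1)
    have := card_finset_fin_le S
    omega
  rw [rightFlag, minor, ← det_transpose, transpose_submatrix, lastEmb_eq]
  change _ = ((orderSign (id ∘ Fin.revPerm : Fin S.card → Fin S.card) : ℤˣ) : ℝ) * _
  rw [orderSign_comp_perm strictMono_id, upperFlag, minor, ← det_permute]
  rfl

lemma card_insert_insert {ι : Type*} [DecidableEq ι] {x y : ι} {K : Finset ι} (hxy : x ≠ y)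
    (hx : x ∉ K) (hy : y ∉ K) : (insert x (insert y K)).card = K.card + 2 := by
  rw [Finset.card_insert_of_notMem (by simp [hxy, hx]), Finset.card_insert_of_notMem hy]

lemma rightFlag_three_term (M : Matrix (Fin n) (Fin n) ℝ) {a b c : Fin n} {K : Finset (Fin n)}
    (hab : a < b) (hbc : b < c) (ha : a ∉ K) (hb : b ∉ K) (hc : c ∉ K) :
    rightFlag M (insert b K) * rightFlag M (insert a (insert c K)) =
      rightFlag M (insert a K) * rightFlag M (insert b (insert c K)) +
        rightFlag M (insert a (insert b K)) * rightFlag M (insert c K) := by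
  have hac := hab.trans hbc
  simp only [rightFlag_eq_orderSign_mul]
  rw [Finset.card_insert_of_notMem ha, Finset.card_insert_of_notMem hb,
    Finset.card_insert_of_notMem hc, card_insert_insert hab.ne ha hb,
    card_insert_insert hac.ne ha hc, card_insert_insert hbc.ne hb hc]
  linear_combination (orderSign (Fin.rev : Fin (K.card + 1) → _) *
    orderSign (Fin.rev : Fin (K.card + 2) → _) : ℝ) *
      upperFlag_three_term (Mᵀ.submatrix Fin.rev id) hab hbc ha hb hc

lemma isPluckerPositive_upperFlag {A : Matrix (Fin n) (Fin n) ℝ} (hA : ∀ S, 0 < upperFlag A S) :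
    IsPluckerPositive (upperFlag A) where
  pos := hA
  three_term := upperFlag_three_term A

lemma isPluckerPositive_rightFlag {M : Matrix (Fin n) (Fin n) ℝ} (hM : ∀ S, 0 < rightFlag M S) :
    IsPluckerPositive (rightFlag M) where
  pos := hM
  three_term := rightFlag_three_term M

end Flag

/-! ### Reversal of the labels -/

section Reversal

lemma exchangeRatio_eq_of_card_mul {ι : Type*} [LinearOrder ι] {p q : Finset ι → ℝ}
    {κ : ℕ → ℝ} (hp : ∀ S, p S ≠ 0) (h : ∀ S, p S = κ S.card * q S) {a b c : ι}
    {K : Finset ι} (hab : a ≠ b) (hbc : b ≠ c) (ha : a ∉ K) (hb : b ∉ K) (hc : c ∉ K) :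
    exchangeRatio p a b c K = exchangeRatio q a b c K := by
  have card_a := Finset.card_insert_of_notMem ha
  have card_c := Finset.card_insert_of_notMem hc
  have card_ab := card_insert_insert hab ha hb
  have card_bc := card_insert_insert hbc hb hc
  have hκ₁ : κ (K.card + 1) ≠ 0 := card_a ▸ left_ne_zero_of_mul (h _ ▸ hp _)
  have hκ₂ : κ (K.card + 2) ≠ 0 := card_ab ▸ left_ne_zero_of_mul (h _ ▸ hp _)
  simp only [exchangeRatio, h, card_a, card_c, card_ab, card_bc]
  rw [mul_mul_mul_comm, mul_mul_mul_comm (κ _) _ (κ _), mul_comm (κ (K.card + 2)),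
    mul_div_mul_left _ _ (mul_ne_zero hκ₁ hκ₂)]

lemma oddGaps_image_rev (a b c : Fin n) :
    (oddGaps a b c).image Fin.rev = evenGaps c.rev b.rev a.rev := by
  ext x
  obtain ⟨y, rfl⟩ := Fin.rev_surjective x
  rw [Fin.rev_injective.mem_finset_image]
  grind [oddGaps, evenGaps]

lemma sum_triples_rev {G : Type*} [AddCommMonoid G] (f : Fin n → Fin n → Fin n → G) :
    ∑ t ∈ triples (Fin n), f t.2.2.rev t.2.1.rev t.1.rev =
      ∑ t ∈ triples (Fin n), f t.1 t.2.1 t.2.2 :=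
  Finset.sum_nbij' (fun t => (t.2.2.rev, t.2.1.rev, t.1.rev))
    (fun t => (t.2.2.rev, t.2.1.rev, t.1.rev)) (by grind [triples])
    (by grind [triples]) (by simp) (by simp) (by simp)

lemma exchangeRatio_image_rev {p q : Finset (Fin n) → ℝ} {κ : ℕ → ℝ} (hp : ∀ S, p S ≠ 0)
    (h : ∀ S, p (S.image Fin.rev) = κ S.card * q S) {a b c : Fin n} (hab : a < b) (hbc : b < c) :
    exchangeRatio q a b c (oddGaps a b c) =
      (exchangeRatio p c.rev b.rev a.rev (evenGaps c.rev b.rev a.rev))⁻¹ := by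
  rw [← exchangeRatio_eq_of_card_mul (fun S => hp (S.image Fin.rev)) h hab.ne hbc.ne
    (by grind [oddGaps]) (by grind [oddGaps]) (by grind [oddGaps]), ← oddGaps_image_rev]
  simp only [exchangeRatio, Finset.image_insert, inv_div]
  rw [Finset.insert_comm c.rev, Finset.insert_comm b.rev a.rev]
  ring

lemma sum_ell_add_sum_ell_inv {ι : Type*} {s : Finset ι} {x : ι → ℝ} (hx : ∀ t ∈ s, 0 < x t) :
    ∑ t ∈ s, ell (x t) + ∑ t ∈ s, ell (x t)⁻¹ = s.card := by
  rw [← Finset.sum_add_distrib, Finset.sum_congr rfl fun t ht => ell_add_ell_inv (hx t ht)]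
  simp

lemma sum_exchangeRatio_of_image_rev {G : Type*} [AddCommMonoid G] (f : ℝ → G)
    {p q : Finset (Fin n) → ℝ} {κ : ℕ → ℝ} (hp : ∀ S, p S ≠ 0)
    (h : ∀ S, p (S.image Fin.rev) = κ S.card * q S) :
    ∑ t ∈ triples (Fin n), f (exchangeRatio q t.1 t.2.1 t.2.2 (oddGaps t.1 t.2.1 t.2.2)) =
      ∑ t ∈ triples (Fin n),
        f (exchangeRatio p t.1 t.2.1 t.2.2 (evenGaps t.1 t.2.1 t.2.2))⁻¹ := by
  rw [← sum_triples_rev fun a b c => f (exchangeRatio p a b c (evenGaps a b c))⁻¹]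
  refine Finset.sum_congr rfl fun t ht => ?_
  have ⟨hab, hbc⟩ : t.1 < t.2.1 ∧ t.2.1 < t.2.2 := by simpa [triples] using ht
  rw [exchangeRatio_image_rev hp h hab hbc]

namespace IsPluckerPositive

variable {p q : Finset (Fin n) → ℝ} {κ : ℕ → ℝ}

theorem sum_ell_add_sum_ell (hp : IsPluckerPositive p)
    (h : ∀ S, p (S.image Fin.rev) = κ S.card * q S) :
    ∑ t ∈ triples (Fin n), ell (exchangeRatio p t.1 t.2.1 t.2.2 (oddGaps t.1 t.2.1 t.2.2)) +
      ∑ t ∈ triples (Fin n), ell (exchangeRatio q t.1 t.2.1 t.2.2 (oddGaps t.1 t.2.1 t.2.2)) =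
      (triples (Fin n)).card := by
  rw [sum_exchangeRatio_of_image_rev ell (fun S => (hp.pos S).ne') h,
    sum_oddGaps_eq_sum_evenGaps (F := fun a b c K => ell (exchangeRatio p a b c K))
      hp.ell_exchangeRatio_eight_term]
  exact sum_ell_add_sum_ell_inv fun t _ => hp.exchangeRatio_pos _ _ _ _

theorem sum_ell_inv_add_sum_ell_inv (hp : IsPluckerPositive p)
    (h : ∀ S, p (S.image Fin.rev) = κ S.card * q S) :
    ∑ t ∈ triples (Fin n), ell (exchangeRatio p t.1 t.2.1 t.2.2 (oddGaps t.1 t.2.1 t.2.2))⁻¹ +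
      ∑ t ∈ triples (Fin n), ell (exchangeRatio q t.1 t.2.1 t.2.2 (oddGaps t.1 t.2.1 t.2.2))⁻¹ =
      (triples (Fin n)).card := by
  rw [sum_exchangeRatio_of_image_rev (fun x => ell x⁻¹) (fun S => (hp.pos S).ne') h]
  simp only [inv_inv]
  rw [← sum_oddGaps_eq_sum_evenGaps (F := fun a b c K => ell (exchangeRatio p a b c K))
      hp.ell_exchangeRatio_eight_term, add_comm]
  exact sum_ell_add_sum_ell_inv fun t _ => hp.exchangeRatio_pos _ _ _ _

end IsPluckerPositive

end Reversal

/-! ### The Gauss decomposition -/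

section Gauss

open Matrix

variable {M M' M'' : Matrix (Fin n) (Fin n) ℝ} {d : Fin n → ℝ}

lemma revMatrix_eq_toMatrix :
    revMatrix n = (Fin.revPerm : Equiv.Perm (Fin n)).toPEquiv.toMatrix := by
  ext i j
  simp only [revMatrix, of_apply, PEquiv.toMatrix_apply, Equiv.toPEquiv_apply, Option.mem_def,
    Option.some_inj, Fin.revPerm_apply, Fin.ext_iff, Fin.val_rev]
  congr 1
  grind

lemma isGauss_iff : IsGauss M M' M'' d ↔ IsUnipotentUpper M' ∧ IsUnipotentUpper M'' ∧
    M.submatrix id Fin.rev = M'.submatrix Fin.rev Fin.rev * diagonal d * M'' := by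
  have left : revMatrix n * M * revMatrix n =
      (M.submatrix id Fin.rev).submatrix Fin.rev id := by
    rw [revMatrix_eq_toMatrix, PEquiv.toMatrix_toPEquiv_mul, PEquiv.mul_toMatrix_toPEquiv]
    rfl
  have right : M' * revMatrix n * diagonal d * M'' =
      (M'.submatrix Fin.rev Fin.rev * diagonal d * M'').submatrix Fin.rev id := by
    rw [revMatrix_eq_toMatrix, PEquiv.mul_toMatrix_toPEquiv]
    ext
    simp [mul_apply]
  have inj : Function.Injective fun A : Matrix (Fin n) (Fin n) ℝ => A.submatrix Fin.rev id :=
    Function.LeftInverse.injective (g := fun A => A.submatrix Fin.rev id) fun A => by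
      change (A.submatrix Fin.rev id).submatrix Fin.rev id = A
      rw [submatrix_submatrix, Fin.rev_involutive.comp_self]
      rfl
  rw [IsGauss, left, right, inj.eq_iff]

lemma isUnipotentUpper_fromBlocks {U : Matrix (Fin n) (Fin n) ℝ} (hU : IsUnipotentUpper U)
    (y : Matrix (Fin n) (Fin 1) ℝ) :
    IsUnipotentUpper
      ((fromBlocks U y 0 1).submatrix finSumFinEquiv.symm finSumFinEquiv.symm) := by
  refine ⟨fun i => ?_, fun i j hij => ?_⟩
  · obtain ⟨i, rfl⟩ := finSumFinEquiv.surjective i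
    cases i <;> simp [hU.1]
  · obtain ⟨i, rfl⟩ := finSumFinEquiv.surjective i
    obtain ⟨j, rfl⟩ := finSumFinEquiv.surjective j
    rcases i with i | i <;> rcases j with j | j
    · simpa using hU.2 i j ((Fin.castAddOrderEmb 1).lt_iff_lt.mp hij)
    · simp [Fin.lt_def] at hij
      omega
    · simp
    · simp [Subsingleton.elim i j] at hij

lemma fromBlocks_eq_lower_mul_diagonal_mul_upper {R m k : Type*} [CommRing R] [Fintype m]
    [DecidableEq m] [Unique k] [DecidableEq k] {A L U : Matrix m m R} {d : m → R} (hA : IsUnit A)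
    (h : A = L * diagonal d * U) (B : Matrix m k R) (C : Matrix k m R) (D : Matrix k k R) :
    fromBlocks A B C D =
      fromBlocks L 0 (C * A⁻¹ * L) 1 * diagonal (Sum.elim d (D - C * A⁻¹ * B).diag) *
        fromBlocks U (U * A⁻¹ * B) 0 1 := by
  have schur : diagonal (D - C * A⁻¹ * B).diag = D - C * A⁻¹ * B := by
    ext i j
    obtain rfl := Subsingleton.elim i j
    simp
  have hdet := (isUnit_iff_isUnit_det A).mp hA
  rw [← fromBlocks_diagonal, schur, fromBlocks_multiply, fromBlocks_multiply]
  have e₁₂ : B = L * diagonal d * (U * A⁻¹ * B) := by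
    rw [← Matrix.mul_assoc, ← Matrix.mul_assoc, ← h, mul_nonsing_inv A hdet, Matrix.one_mul]
  have e₂₁ : C = C * A⁻¹ * L * diagonal d * U := by
    simp only [Matrix.mul_assoc]
    rw [← Matrix.mul_assoc L, ← h, nonsing_inv_mul A hdet, Matrix.mul_one]
  have e₂₂ : D = C * A⁻¹ * L * diagonal d * (U * A⁻¹ * B) + (D - C * A⁻¹ * B) := by
    rw [← Matrix.mul_assoc, ← Matrix.mul_assoc _ U, ← e₂₁]
    abel
  simp [← h, ← e₁₂, ← e₂₁, ← e₂₂]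

lemma exists_eq_lower_mul_diagonal_mul_upper (A : Matrix (Fin n) (Fin n) ℝ)
    (hA : ∀ k (hk : k < n), (A.submatrix (Fin.castLE hk.le) (Fin.castLE hk.le)).det ≠ 0) :
    ∃ (L U : Matrix (Fin n) (Fin n) ℝ) (d : Fin n → ℝ),
      IsUnipotentUpper Lᵀ ∧ IsUnipotentUpper U ∧ A = L * diagonal d * U := by
  induction n with
  | zero =>
    exact ⟨1, 1, 0, by simp [IsUnipotentUpper], by simp [IsUnipotentUpper], Subsingleton.elim _ _⟩
  | succ n ih =>
    obtain ⟨L, U, d, hL, hU, h⟩ := ih (A.submatrix Fin.castSucc Fin.castSucc)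
      fun k hk => hA k (hk.trans n.lt_succ_self)
    let e : Fin n ⊕ Fin 1 ≃ Fin (n + 1) := finSumFinEquiv
    let B := A.submatrix e e
    have block : IsUnit B.toBlocks₁₁ :=
      (isUnit_iff_isUnit_det _).mpr (hA n n.lt_succ_self).isUnit
    have ldu := fromBlocks_eq_lower_mul_diagonal_mul_upper block h B.toBlocks₁₂ B.toBlocks₂₁
      B.toBlocks₂₂
    refine ⟨(fromBlocks L 0 (B.toBlocks₂₁ * B.toBlocks₁₁⁻¹ * L) 1).submatrix e.symm e.symm,
      (fromBlocks U (U * B.toBlocks₁₁⁻¹ * B.toBlocks₁₂) 0 1).submatrix e.symm e.symm,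
      Sum.elim d (B.toBlocks₂₂ - B.toBlocks₂₁ * B.toBlocks₁₁⁻¹ * B.toBlocks₁₂).diag ∘ e.symm,
      ?_, isUnipotentUpper_fromBlocks hU _, ?_⟩
    · rw [transpose_submatrix, fromBlocks_transpose]
      simpa using isUnipotentUpper_fromBlocks hL _
    · calc A = B.submatrix e.symm e.symm := by simp [B]
        _ = _ := by
          rw [← submatrix_diagonal_equiv, submatrix_mul_equiv, submatrix_mul_equiv]
          exact congrArg (submatrix · e.symm e.symm) ((fromBlocks_toBlocks B).symm.trans ldu)

lemma det_submatrix_castLE (A : Matrix (Fin n) (Fin n) ℝ) {k : ℕ} (hk : k ≤ n) :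
    (A.submatrix (Fin.castLE hk) (Fin.castLE hk)).det =
      upperFlag A (Finset.univ.image (Fin.castLE hk)) := by
  rw [upperFlag_eq_orderSign_mul A hk (Fin.castLE_injective hk) (by simp),
    orderSign_of_strictMono (Fin.strictMono_castLE hk), Units.val_one,
    Int.cast_one, one_mul]

lemma isGauss_prime_dprime
    (h : ∀ k (hk : k < n),
      ((M.submatrix id Fin.rev).submatrix (Fin.castLE hk.le) (Fin.castLE hk.le)).det ≠ 0) :
    ∃ d, IsGauss M (prime M) (dprime M) d := by
  have gauss : ∃ p : Matrix (Fin n) (Fin n) ℝ × Matrix (Fin n) (Fin n) ℝ,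
      ∃ d, IsGauss M p.1 p.2 d := by
    obtain ⟨L, U, d, hL, hU, ldu⟩ := exists_eq_lower_mul_diagonal_mul_upper _ h
    refine ⟨(L.submatrix Fin.rev Fin.rev, U), d, isGauss_iff.mpr ⟨⟨fun i => hL.1 _,
      fun i j hij => hL.2 _ _ (Fin.rev_lt_rev.mpr hij)⟩, hU, ?_⟩⟩
    simpa [Fin.rev_involutive.comp_self] using ldu
  rw [prime, dprime, gaussPair, dif_pos gauss]
  exact gauss.choose_spec

lemma isGauss_of_upperFlag_pos (h : ∀ J, 0 < upperFlag M J) :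
    ∃ d, IsGauss M (prime M) (dprime M) d := by
  refine isGauss_prime_dprime fun k hk => ?_
  rw [det_submatrix_castLE]
  exact right_ne_zero_of_mul (upperFlag_image_rev M _ ▸ (h _).ne')

lemma isGauss_of_rightFlag_pos (h : ∀ I, 0 < rightFlag M I) :
    ∃ d, IsGauss M (prime M) (dprime M) d := by
  refine isGauss_prime_dprime fun k hk => ?_
  rw [← det_transpose, transpose_submatrix, transpose_submatrix, det_submatrix_castLE]
  exact right_ne_zero_of_mul (rightFlag_eq_orderSign_mul M _ ▸ (h _).ne')

lemma exists_upperFlag_image_rev {A A' L : Matrix (Fin n) (Fin n) ℝ}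
    (hL : L.IsLowerTriangular) (h : A.submatrix id Fin.rev = L * A') :
    ∃ κ : ℕ → ℝ, ∀ S, upperFlag A (S.image Fin.rev) = κ S.card * upperFlag A' S :=
  ⟨fun k => orderSign (Fin.rev : Fin k → Fin k) * ∏ i ∈ {i : Fin n | (i : ℕ) < k}, L i i,
    fun S => by rw [upperFlag_image_rev, h, upperFlag_lower_mul hL, mul_assoc]⟩

namespace IsGauss

lemma exists_upperFlag_image_rev (h : IsGauss M M' M'' d) :
    ∃ κ : ℕ → ℝ, ∀ J, upperFlag M (J.image Fin.rev) = κ J.card * upperFlag M'' J := by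
  obtain ⟨hM', -, ldu⟩ := isGauss_iff.mp h
  refine TotPos.exists_upperFlag_image_rev (fun i j (hij : i < j) => ?_) ldu
  rw [mul_diagonal, submatrix_apply, hM'.2 _ _ (Fin.rev_lt_rev.mpr hij), zero_mul]

lemma exists_rightFlag_image_rev (h : IsGauss M M' M'' d) :
    ∃ κ : ℕ → ℝ, ∀ I, rightFlag M (I.image Fin.rev) = κ I.card * rightFlag M' I := by
  obtain ⟨-, hM'', ldu⟩ := isGauss_iff.mp h
  have transposed : (Mᵀ.submatrix Fin.rev id).submatrix id Fin.rev =
      M''ᵀ * diagonal d * M'ᵀ.submatrix Fin.rev id := by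
    ext i j
    have entry := congrFun₂ ldu j.rev i
    rw [mul_apply] at entry ⊢
    simpa [mul_diagonal, mul_comm, mul_left_comm] using entry
  have lower : (M''ᵀ * diagonal d).IsLowerTriangular := fun i j (hij : i < j) => by
    rw [mul_diagonal, transpose_apply, hM''.2 _ _ hij, zero_mul]
  obtain ⟨κ, hκ⟩ := TotPos.exists_upperFlag_image_rev lower transposed
  refine ⟨κ, fun I => ?_⟩
  rw [rightFlag_eq_orderSign_mul, rightFlag_eq_orderSign_mul, hκ,
    Finset.card_image_of_injective _ Fin.rev_injective, mul_left_comm]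

end IsGauss

end Gauss

/-! ### Total positivity and labels -/

section TotalPositivity

open Matrix

variable {M : Matrix (Fin n) (Fin n) ℝ}

lemma exists_isUnipotentUpper_minor_ne_zero {k : ℕ} {r c : Fin k ↪o Fin n} (h : ∀ i, r i ≤ c i) :
    ∃ G : Matrix (Fin n) (Fin n) ℝ, IsUnipotentUpper G ∧ minor G r c ≠ 0 := by
  classical
  refine ⟨of fun i j => if i = j ∨ ∃ l, r l = i ∧ c l = j then 1 else 0,
    ⟨by simp, fun i j hji => if_neg ?_⟩, ?_⟩
  · rintro (rfl | ⟨l, rfl, rfl⟩)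
    · exact hji.false
    · exact (h l).not_gt hji
  · rw [minor, det_of_isLowerTriangular]
    · exact Finset.prod_ne_zero_iff.mpr fun i _ => by simp
    · intro i j (hij : i < j)
      refine if_neg ?_
      rintro (hr | ⟨l, hr, hc⟩)
      · exact (c.le_iff_le.mp (hr ▸ h i)).not_gt hij
      · exact hij.ne ((r.injective hr).symm.trans (c.injective hc))

lemma val_le_val_of_strictMono {k : ℕ} {c : Fin k → Fin n} (hc : StrictMono c) (i : Fin k) :
    (i : ℕ) ≤ c i := by
  simpa using Finset.card_le_card_of_injOn (s := Finset.Iio i) (t := Finset.Iio (c i)) c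
    (fun j hj => by simpa using hc (by simpa using hj)) hc.injective.injOn

lemma le_lastEmb_of_strictMono {k : ℕ} (hk : k ≤ n) {r : Fin k → Fin n} (hr : StrictMono r)
    (i : Fin k) : r i ≤ lastEmb hk i := by
  have h := val_le_val_of_strictMono (c := Fin.rev ∘ r ∘ Fin.rev)
    (Fin.rev_strictAnti.comp (hr.comp_strictAnti Fin.rev_strictAnti)) i.rev
  simp only [Function.comp_apply, Fin.rev_rev, Fin.val_rev] at h
  rw [Fin.le_def]
  change (r i : ℕ) ≤ n - k + i
  omega

namespace IsTotallyPositive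

lemma minor_pos (hM : IsTotallyPositive M) {k : ℕ} {r c : Fin k ↪o Fin n}
    (h : ∀ i, r i ≤ c i) : 0 < minor M r c :=
  hM.2 k r c (exists_isUnipotentUpper_minor_ne_zero h)

lemma rightFlag_pos (hM : IsTotallyPositive M) (I : Finset (Fin n)) : 0 < rightFlag M I :=
  hM.minor_pos (le_lastEmb_of_strictMono _ (I.orderEmbOfFin rfl).strictMono)

lemma upperFlag_pos (hM : IsTotallyPositive M) (J : Finset (Fin n)) : 0 < upperFlag M J :=
  hM.minor_pos (val_le_val_of_strictMono (J.orderEmbOfFin rfl).strictMono)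

end IsTotallyPositive

end TotalPositivity

section Labels

lemma card_triples (ι : Type*) [LinearOrder ι] [Fintype ι] :
    (triples ι).card = (Fintype.card ι).choose 3 := by
  let e : triples ι ≃ (Fin 3 ↪o ι) :=
    { toFun t := OrderEmbedding.ofStrictMono ![t.1.1, t.1.2.1, t.1.2.2] <| by
        simpa [triples] using t.2
      invFun f := ⟨(f 0, f 1, f 2), by simp [triples]⟩
      left_inv _ := rfl
      right_inv f := by ext i; fin_cases i <;> rfl }
  rw [← Nat.card_eq_fintype_card, ← Set.powersetCard.card,
    ← Nat.card_congr (e.trans Set.powersetCard.ofFinEmbEquiv), Nat.card_eq_fintype_card,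
    Fintype.card_coe]

lemma cast_choose_three (n : ℕ) :
    (n.choose 3 : ℝ) = n * ((n : ℝ) - 1) * ((n : ℝ) - 2) / 6 := by
  rw [Nat.cast_choose_eq_descPochhammer_div]
  simp [descPochhammer_succ_right, Nat.factorial]

lemma sum_tetra {G : Type*} [AddCommMonoid G] (f : ℕ → ℕ → ℕ → G) :
    ∑ t ∈ tetra n, f t.1 t.2.1 t.2.2 =
      ∑ t ∈ triples (Fin n), f (t.1 + 1) (t.2.1 + 1) (t.2.2 + 1) := by
  symm
  refine Finset.sum_nbij (fun t => (t.1 + 1, t.2.1 + 1, t.2.2 + 1)) ?_ ?_ ?_ ?_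
  · grind [triples, tetra]
  · grind [triples, tetra, Set.InjOn]
  · rintro ⟨a, b, c⟩ h
    refine ⟨(⟨a - 1, by grind [tetra]⟩, ⟨b - 1, by grind [tetra]⟩, ⟨c - 1, by grind [tetra]⟩), ?_⟩
    grind [triples, tetra]
  · simp

lemma Ylow_eq_exchangeRatio (M : Matrix (Fin n) (Fin n) ℝ) {a b c : Fin n} (hab : a < b)
    (hbc : b < c) :
    Ylow (a + 1) (b + 1) (c + 1) M = exchangeRatio (rightFlag M) a b c (oddGaps a b c) := by
  unfold Ylow exchangeRatio
  congr 3 <;> ext i <;> grind [seg, oddGaps]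

lemma Yup_eq_inv_exchangeRatio (M : Matrix (Fin n) (Fin n) ℝ) {a b c : Fin n} (hab : a < b)
    (hbc : b < c) :
    Yup (a + 1) (b + 1) (c + 1) M = (exchangeRatio (upperFlag M) a b c (oddGaps a b c))⁻¹ := by
  unfold Yup exchangeRatio
  rw [inv_div]
  congr 3 <;> ext i <;> grind [seg, oddGaps]

lemma sum_ell_Ylow (M : Matrix (Fin n) (Fin n) ℝ) :
    ∑ t ∈ tetra n, ell (Ylow t.1 t.2.1 t.2.2 M) = ∑ t ∈ triples (Fin n),
      ell (exchangeRatio (rightFlag M) t.1 t.2.1 t.2.2 (oddGaps t.1 t.2.1 t.2.2)) := by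
  refine (sum_tetra fun a b c => ell (Ylow a b c M)).trans (Finset.sum_congr rfl fun t ht => ?_)
  have ⟨hab, hbc⟩ : t.1 < t.2.1 ∧ t.2.1 < t.2.2 := by simpa [triples] using ht
  rw [Ylow_eq_exchangeRatio M hab hbc]

lemma sum_ell_Yup (M : Matrix (Fin n) (Fin n) ℝ) :
    ∑ t ∈ tetra n, ell (Yup t.1 t.2.1 t.2.2 M) = ∑ t ∈ triples (Fin n),
      ell (exchangeRatio (upperFlag M) t.1 t.2.1 t.2.2 (oddGaps t.1 t.2.1 t.2.2))⁻¹ := by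
  refine (sum_tetra fun a b c => ell (Yup a b c M)).trans (Finset.sum_congr rfl fun t ht => ?_)
  have ⟨hab, hbc⟩ : t.1 < t.2.1 ∧ t.2.1 < t.2.2 := by simpa [triples] using ht
  rw [Yup_eq_inv_exchangeRatio M hab hbc]

end Labels

end TotPos

end

theorem proposition3p6_general (n : ℕ) (M : Matrix (Fin n) (Fin n) ℝ) :
    ((∀ I, 0 < TotPos.rightFlag M I) →
      (∑ t ∈ TotPos.tetra n, TotPos.ell (TotPos.Ylow t.1 t.2.1 t.2.2 M)) +
          ∑ t ∈ TotPos.tetra n, TotPos.ell (TotPos.Ylow t.1 t.2.1 t.2.2 (TotPos.prime M)) =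
        (n : ℝ) * ((n : ℝ) - 1) * ((n : ℝ) - 2) / 6) ∧
    ((∀ J, 0 < TotPos.upperFlag M J) →
      (∑ t ∈ TotPos.tetra n, TotPos.ell (TotPos.Yup t.1 t.2.1 t.2.2 M)) +
          ∑ t ∈ TotPos.tetra n, TotPos.ell (TotPos.Yup t.1 t.2.1 t.2.2 (TotPos.dprime M)) =
        (n : ℝ) * ((n : ℝ) - 1) * ((n : ℝ) - 2) / 6) := by
  have count : ((TotPos.triples (Fin n)).card : ℝ) = n * ((n : ℝ) - 1) * ((n : ℝ) - 2) / 6 := by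
    rw [TotPos.card_triples, Fintype.card_fin, TotPos.cast_choose_three]
  rw [← count]
  refine ⟨fun hM => ?_, fun hM => ?_⟩
  · obtain ⟨d, gauss⟩ := TotPos.isGauss_of_rightFlag_pos hM
    obtain ⟨κ, hκ⟩ := gauss.exists_rightFlag_image_rev
    rw [TotPos.sum_ell_Ylow, TotPos.sum_ell_Ylow]
    exact (TotPos.isPluckerPositive_rightFlag hM).sum_ell_add_sum_ell hκ
  · obtain ⟨d, gauss⟩ := TotPos.isGauss_of_upperFlag_pos hM
    obtain ⟨κ, hκ⟩ := gauss.exists_upperFlag_image_rev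
    rw [TotPos.sum_ell_Yup, TotPos.sum_ell_Yup]
    exact (TotPos.isPluckerPositive_upperFlag hM).sum_ell_inv_add_sum_ell_inv hκ

theorem proposition3p6 (n : ℕ) (M : Matrix (Fin n) (Fin n) ℝ)
    (hM : TotPos.IsTotallyPositive M) :
    ((∑ t ∈ TotPos.tetra n, TotPos.ell (TotPos.Ylow t.1 t.2.1 t.2.2 M)) +
        ∑ t ∈ TotPos.tetra n, TotPos.ell (TotPos.Ylow t.1 t.2.1 t.2.2 (TotPos.prime M)) =
      (n : ℝ) * ((n : ℝ) - 1) * ((n : ℝ) - 2) / 6) ∧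
    ((∑ t ∈ TotPos.tetra n, TotPos.ell (TotPos.Yup t.1 t.2.1 t.2.2 M)) +
        ∑ t ∈ TotPos.tetra n, TotPos.ell (TotPos.Yup t.1 t.2.1 t.2.2 (TotPos.dprime M)) =
      (n : ℝ) * ((n : ℝ) - 1) * ((n : ℝ) - 2) / 6) := by
  have general := proposition3p6_general n M
  exact ⟨general.1 hM.rightFlag_pos, general.2 hM.upperFlag_pos⟩
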